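/- Let $n,m\ge 1$ and let $B_{n,m}=\langle a,b \mid ab^n=b^ma\rangle$ be the Baumslag–Solitar monoid, which is a right LCM monoid with trivial unit group. For $F\subseteq P=B_{n,m}$ finite, write $\vee F=\{r\in P:\bigcap_{x\in F}xP=rP\}$ (so $\vee\emptyset=\{e\}$) and $p\vee q=\vee\{p,q\}$; when $s\in pP$, write $p^{-1}s$ for the unique $u$ with $s=pu$. Let $H$ be a complex Hilbert space and let $T:B_{n,m}\to B(H)$ be a unital contractive representation, i.e. a monoid homomorphism with $T(e)=I$ and $\|T(p)\|\le 1$ for all $p$. Put $$K(p,q)=T(p^{-1}s)\,T(q^{-1}s)^*\quad (s\in p\vee q),\qquad K(p,q)=0 \text{ if } p\vee q=\emptyset,$$ and call $T$ $*$-regular if $K$ is completely positive definite, i.e. the operator matrix $[K(p_i,p_j)]_{i,j=1}^N$ on $H^N$ is positive for all $N$ and all $p_1,\dots,p_N\in P$. For finite $F\subseteq P$ put $$Z(F)=\sum_{U\subseteq F}(-1)^{|U|}\,TT^*(\vee U),\qquad TT^*(\vee U)=T(s)T(s)^*\ (s\in\vee U),\quad TT^*(\vee U)=0\text{ if }\vee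 U=\emptyset.$$ Then $T$ is $*$-regular if and only if $Z(F)\ge 0$ for every finite subset $F$ of $P_{00}=\{b\}\cup\{b^ia:0\le i\le m-1\}$. -/

import Mathlib

namespace RegDil

section General

variable {P : Type*} [Monoid P] {H : Type*} [NormedAddCommGroup H] [InnerProductSpace ℂ H]
  [CompleteSpace H]

/-- The principal right ideal `pP`. -/
def rightIdeal (p : P) : Set P := {x | ∃ y, x = p * y}

/-- `⋁F`, the set of all `r` such that the intersection of the `xP`, `x ∈ F`, equals `rP`. For
`F = ∅` the intersection is all of `P`. -/
def joinSet (F : Set P) : Set P := {r | (⋂ x ∈ F, rightIdeal x) = rightIdeal r}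

open Classical in
/-- `p⁻¹s`: the element `u` with `s = pu` (unique when `P` is left cancellative), for `s ∈ pP`;
the value `1` is assigned when `s ∉ pP`. -/
noncomputable def leftQuot (p s : P) : P := if h : ∃ u, s = p * u then h.choose else 1

open Classical in
/-- The kernel `K(p,q) = T(p⁻¹s) T(q⁻¹s)*` with `s ∈ p ∨ q`, and `K(p,q) = 0` if `p ∨ q = ∅`.
For a contractive representation of a right LCM monoid the choice of `s` is immaterial. -/
noncomputable def kernel (T : P →* (H →L[ℂ] H)) (p q : P) : H →L[ℂ] H :=
  if h : (joinSet ({p, q} : Set P)).Nonempty then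
    T (leftQuot p h.some) * ContinuousLinearMap.adjoint (T (leftQuot q h.some))
  else 0

/-- Complete positive definiteness of a kernel: for all `p₁, …, p_N`, the operator matrix
`[K(p_i, p_j)]` on `H^N` is positive (with the order of `ℂ`, so the form is real and `≥ 0`). -/
def IsCompletelyPosDef (K : P → P → (H →L[ℂ] H)) : Prop :=
  ∀ (N : ℕ) (p : Fin N → P) (h : Fin N → H),
    0 ≤ (∑ i, ∑ j, inner ℂ (h i) (K (p i) (p j) (h j))).re ∧
      (∑ i, ∑ j, inner ℂ (h i) (K (p i) (p j) (h j))).im = 0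

/-- `T` is `*`-regular (has a `*`-regular dilation): its kernel is completely positive definite. -/
def IsStarRegular (T : P →* (H →L[ℂ] H)) : Prop := IsCompletelyPosDef (kernel T)

open Classical in
/-- `TT*(⋁F) = T(s) T(s)*` with `s ∈ ⋁F`, and `0` if `⋁F = ∅`.
For a contractive representation the choice of `s` is immaterial when `P` is left cancellative. -/
noncomputable def rangeJoin (T : P →* (H →L[ℂ] H)) (F : Set P) : H →L[ℂ] H :=
  if h : (joinSet F).Nonempty then T h.some * ContinuousLinearMap.adjoint (T h.some) else 0

/-- `Z(F)`, the sum over `U ⊆ F` of `(-1)^|U| TT*(⋁U)`. -/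
noncomputable def Z (T : P →* (H →L[ℂ] H)) (F : Finset P) : H →L[ℂ] H :=
  ∑ U ∈ F.powerset, (-1 : ℂ) ^ U.card • rangeJoin T (U : Set P)

end General

/-- The two letters `a`, `b`. -/
inductive Letter
  | a
  | b

/-- The single defining relation `a bⁿ = bᵐ a`. -/
def bsRel (n m : ℕ) (x y : FreeMonoid Letter) : Prop :=
  x = FreeMonoid.of Letter.a * FreeMonoid.of Letter.b ^ n ∧
    y = FreeMonoid.of Letter.b ^ m * FreeMonoid.of Letter.a

/-- The Baumslag–Solitar monoid `B_{n,m} = ⟨a, b | a bⁿ = bᵐ a⟩`. -/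
abbrev BSMonoid (n m : ℕ) : Type := PresentedMonoid (bsRel n m)

/-- The generator `a` of `B_{n,m}`. -/
def genA (n m : ℕ) : BSMonoid n m := PresentedMonoid.of (bsRel n m) Letter.a

/-- The generator `b` of `B_{n,m}`. -/
def genB (n m : ℕ) : BSMonoid n m := PresentedMonoid.of (bsRel n m) Letter.b

/-- `P₀₀ = {b} ∪ {bⁱa : 0 ≤ i ≤ m - 1}`. -/
def P00 (n m : ℕ) : Set (BSMonoid n m) :=
  {genB n m} ∪ {x | ∃ i : ℕ, i < m ∧ x = genB n m ^ i * genA n m}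

end RegDil

namespace RegDil

/-! ### Normal forms and left cancellation in `BSMonoid n m`. -/

section Monoid

variable {n m : ℕ}

/-! Regularity gives `Z(F) ≥ 0` for every finite `F`: test the kernel at the joins `⋁U`, `U ⊆ F`, on
the vectors `(-1)^|U| T(⋁U)* x`; inclusion-exclusion collapses the double sum to `⟨x, Z(F)x⟩`
(`IsStarRegular.isPositive_Z`).

Conversely, only three sets are needed: `{b}`, `{a, b}` and `{bⁱa : i < m}`. Any finite family of
elements lies in a join-closed `box`. On a box there are points `s` with positive weights `D_s` such
that `∑_{s ∈ rP} T(r⁻¹s) D_s T(r⁻¹s)* = 1` for every `r` in the box (`HasResolution`). Inserting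
this identity at `r = p ∨ q` writes `K(p,q)` as `∑ T(p⁻¹s) D_s T(q⁻¹s)*` over `s ∈ pP ∩ qP`
(`kernel_eq_sum`), a sum of positive Gram kernels. The weights are `Z{b}` and `1` at level zero;
each further level adds powers of `b` with weights `Z{a,b}` and `Z{bⁱa}`, and copies of the
preceding resolution under the heads `bⁱa` (`hasResolution_box_succ`). -/

theorem genA_mul_genB_pow (n m : ℕ) : genA n m * genB n m ^ n = genB n m ^ m * genA n m := by
  have h := PresentedMonoid.mk_eq_mk_of_rel (rels := bsRel n m) ⟨rfl, rfl⟩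
  rw [map_mul, map_mul, map_pow, map_pow] at h
  exact h

theorem genB_pow_mul_genA (n m q r : ℕ) :
    genB n m ^ (m * q + r) * genA n m = genB n m ^ r * genA n m * genB n m ^ (n * q) := by
  induction q with
  | zero => simp
  | succ q ih =>
    rw [show m * (q + 1) + r = m * q + r + m by ring, pow_add, mul_assoc, ← genA_mul_genB_pow,
      ← mul_assoc, ih, mul_assoc, ← pow_add, mul_add_one]

theorem genB_pow_mul_genA' (n m j : ℕ) :
    genB n m ^ j * genA n m = genB n m ^ (j % m) * genA n m * genB n m ^ (n * (j / m)) := by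
  conv_lhs => rw [← Nat.div_add_mod j m]
  rw [genB_pow_mul_genA]

/-- Quantifying over the prefix `bᶜ` lets word induction absorb a leading letter `b` into the
exponent. -/
theorem bs_induction_word {Q : BSMonoid n m → Prop} (hb : ∀ j, Q (genB n m ^ j))
    (ha : ∀ i p, (∀ c, Q (genB n m ^ c * p)) → Q (genB n m ^ i * genA n m * p))
    (p : BSMonoid n m) : ∀ c, Q (genB n m ^ c * p) := by
  induction p using PresentedMonoid.inductionOn with
  | h w =>
    induction w using FreeMonoid.inductionOn' with
    | one => intro c; simpa using hb c
    | of_mul x w ih =>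
      intro c
      rw [map_mul]
      cases x with
      | a =>
        rw [← mul_assoc]
        exact ha c _ ih
      | b =>
        have := ih (c + 1)
        rw [pow_succ, mul_assoc] at this
        exact this

/-- Every element is a power of `b` or of the form `bⁱap` with `i < m`. -/
@[elab_as_elim]
theorem bs_induction (hm : 1 ≤ m) {Q : BSMonoid n m → Prop} (p : BSMonoid n m)
    (hb : ∀ j, Q (genB n m ^ j))
    (ha : ∀ i p, i < m → Q p → Q (genB n m ^ i * genA n m * p)) : Q p := by
  have := bs_induction_word hb (fun i p h => ?_) p 0
  · simpa using this
  · rw [genB_pow_mul_genA', mul_assoc]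
    exact ha _ _ (Nat.mod_lt _ hm) (h _)

/-- The right action of the letters on normal forms: `inl j` stands for `bʲ`, and `inr (i, p)` for
`bⁱap`. -/
def letterAct (n m : ℕ) :
    Letter → ℕ ⊕ ℕ × BSMonoid n m → ℕ ⊕ ℕ × BSMonoid n m
  | .a, .inl j => .inr (j % m, genB n m ^ (n * (j / m)))
  | .b, .inl j => .inl (j + 1)
  | .a, .inr (i, p) => .inr (i, p * genA n m)
  | .b, .inr (i, p) => .inr (i, p * genB n m)

/-- The right action of a letter as an endomorphism of the set of normal forms. -/
def letterEnd (n m : ℕ) (x : Letter) : Function.End (ℕ ⊕ ℕ × BSMonoid n m) :=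
  letterAct n m x

theorem letterEnd_b_pow_inl (k j : ℕ) :
    (letterEnd n m .b ^ k) (.inl j) = .inl (j + k) := by
  induction k with
  | zero => rfl
  | succ k ih =>
    rw [pow_succ']
    change letterEnd n m .b ((letterEnd n m .b ^ k) (.inl j)) = _
    rw [ih]
    rfl

theorem letterEnd_b_pow_inr (k i : ℕ) (p : BSMonoid n m) :
    (letterEnd n m .b ^ k) (.inr (i, p)) = .inr (i, p * genB n m ^ k) := by
  induction k with
  | zero => rw [pow_zero, pow_zero, mul_one]; rfl
  | succ k ih =>
    rw [pow_succ']
    change letterEnd n m .b ((letterEnd n m .b ^ k) (.inr (i, p))) = _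
    rw [ih, pow_succ, ← mul_assoc]
    rfl

/-- The order is reversed because the letters act from the right. This is what lets the action
descend to the monoid. -/
theorem letterEnd_rel (hm : 1 ≤ m) :
    letterEnd n m .b ^ n * letterEnd n m .a = letterEnd n m .a * letterEnd n m .b ^ m := by
  funext s
  change (letterEnd n m .b ^ n) (letterEnd n m .a s) =
    letterEnd n m .a ((letterEnd n m .b ^ m) s)
  rcases s with j | ⟨i, p⟩
  · rw [letterEnd_b_pow_inl]
    change (letterEnd n m .b ^ n) (.inr (j % m, genB n m ^ (n * (j / m)))) =
      .inr ((j + m) % m, genB n m ^ (n * ((j + m) / m)))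
    rw [letterEnd_b_pow_inr, ← pow_add, Nat.add_mod_right, Nat.add_div_right _ hm, mul_add_one]
  · rw [letterEnd_b_pow_inr]
    change (letterEnd n m .b ^ n) (.inr (i, p * genA n m)) =
      .inr (i, p * genB n m ^ m * genA n m)
    rw [letterEnd_b_pow_inr, mul_assoc, mul_assoc, genA_mul_genB_pow]

/-- The right action of `B_{n,m}` on normal forms. -/
def normalAct (hm : 1 ≤ m) :
    BSMonoid n m →* (Function.End (ℕ ⊕ ℕ × BSMonoid n m))ᵐᵒᵖ :=
  PresentedMonoid.lift (fun x => MulOpposite.op (letterEnd n m x)) (by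
    rintro _ _ ⟨rfl, rfl⟩
    simp only [map_mul, map_pow, FreeMonoid.lift_eval_of]
    exact congrArg MulOpposite.op (letterEnd_rel hm))

/-- The normal form of an element. -/
def normalForm (hm : 1 ≤ m) (p : BSMonoid n m) : ℕ ⊕ ℕ × BSMonoid n m :=
  (normalAct hm p).unop (.inl 0)

theorem normalAct_mul (hm : 1 ≤ m) (p q : BSMonoid n m) (s : ℕ ⊕ ℕ × BSMonoid n m) :
    (normalAct hm (p * q)).unop s = (normalAct hm q).unop ((normalAct hm p).unop s) := by
  rw [map_mul]; rfl

theorem normalAct_genB_pow (hm : 1 ≤ m) (j k : ℕ) :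
    (normalAct (n := n) hm (genB n m ^ k)).unop (.inl j) = .inl (j + k) := by
  induction k with
  | zero => rw [pow_zero, map_one]; rfl
  | succ k ih => rw [pow_succ, normalAct_mul, ih]; rfl

theorem normalForm_genB_pow (hm : 1 ≤ m) (j : ℕ) :
    normalForm hm (genB n m ^ j) = .inl j := by
  rw [normalForm, normalAct_genB_pow, zero_add]

theorem normalAct_inr (hm : 1 ≤ m) (i : ℕ) (p q : BSMonoid n m) :
    (normalAct hm q).unop (.inr (i, p)) = .inr (i, p * q) := by
  induction q using PresentedMonoid.inductionOn with
  | h w =>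
    induction w using FreeMonoid.inductionOn' generalizing p with
    | one => rw [map_one, map_one, mul_one]; rfl
    | of_mul x w ih =>
      rw [map_mul, normalAct_mul, ← mul_assoc, ← ih]
      cases x <;> rfl

/-- Source of the uniqueness of normal forms: head residue and tail can be read off from the
element. -/
theorem normalForm_genB_pow_mul_genA_mul (hm : 1 ≤ m) (j : ℕ) (p : BSMonoid n m) :
    normalForm hm (genB n m ^ j * genA n m * p) =
      .inr (j % m, genB n m ^ (n * (j / m)) * p) := by
  rw [normalForm, normalAct_mul, normalAct_mul, normalAct_genB_pow, zero_add, ← normalAct_inr hm]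
  rfl

theorem genB_pow_injective (hm : 1 ≤ m) {j k : ℕ} (h : genB n m ^ j = genB n m ^ k) : j = k := by
  have := congrArg (normalForm hm) h
  simpa only [normalForm_genB_pow, Sum.inl.injEq] using this

theorem genB_pow_ne (hm : 1 ≤ m) (j i : ℕ) (p : BSMonoid n m) :
    genB n m ^ j ≠ genB n m ^ i * genA n m * p := by
  intro h
  have := congrArg (normalForm hm) h
  rw [normalForm_genB_pow, normalForm_genB_pow_mul_genA_mul] at this
  cases this

theorem genB_pow_mul_genA_mul_inj (hm : 1 ≤ m) {i j : ℕ} {p q : BSMonoid n m}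
    (h : genB n m ^ i * genA n m * p = genB n m ^ j * genA n m * q) :
    i % m = j % m ∧ genB n m ^ (n * (i / m)) * p = genB n m ^ (n * (j / m)) * q := by
  have := congrArg (normalForm hm) h
  simpa only [normalForm_genB_pow_mul_genA_mul, Sum.inr.injEq, Prod.mk.injEq] using this

theorem genB_pow_mul_genA_mul_inj_of_lt (hm : 1 ≤ m) {i j : ℕ} (hi : i < m) (hj : j < m)
    {p q : BSMonoid n m} (h : genB n m ^ i * genA n m * p = genB n m ^ j * genA n m * q) :
    i = j ∧ p = q := by
  have := genB_pow_mul_genA_mul_inj hm h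
  simpa [Nat.mod_eq_of_lt, Nat.div_eq_of_lt, hi, hj] using this

theorem bs_cases (hm : 1 ≤ m) (p : BSMonoid n m) :
    (∃ j, p = genB n m ^ j) ∨ ∃ i q, i < m ∧ p = genB n m ^ i * genA n m * q :=
  bs_induction hm p (fun j => .inl ⟨j, rfl⟩) (fun i p hi _ => .inr ⟨i, p, hi, rfl⟩)

/-- A factor `bᶜ` rotates the head residue and passes to the tail as another power of `b`, so the
induction must cover all `c` at once. -/
theorem genB_pow_mul_left_cancel (hm : 1 ≤ m) (p : BSMonoid n m) :
    ∀ (c : ℕ) (q : BSMonoid n m), genB n m ^ c * p = genB n m ^ c * q → p = q := by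
  refine bs_induction hm p (fun j c q h => ?_) (fun i p hi ih c q h => ?_)
  · rcases bs_cases hm q with ⟨k, rfl⟩ | ⟨k, q, hk, rfl⟩
    · rw [← pow_add, ← pow_add] at h
      rw [Nat.add_left_cancel (genB_pow_injective hm h)]
    · rw [← pow_add, ← mul_assoc, ← mul_assoc, ← pow_add] at h
      exact absurd h (genB_pow_ne hm _ _ _)
  · rcases bs_cases hm q with ⟨k, rfl⟩ | ⟨k, q, hk, rfl⟩
    · rw [← pow_add, ← mul_assoc, ← mul_assoc, ← pow_add] at h
      exact absurd h.symm (genB_pow_ne hm _ _ _)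
    · simp only [← mul_assoc, ← pow_add] at h
      obtain ⟨h1, h2⟩ := genB_pow_mul_genA_mul_inj hm h
      obtain rfl : i = k := by
        have := Nat.ModEq.add_left_cancel' c h1
        rwa [Nat.ModEq, Nat.mod_eq_of_lt hi, Nat.mod_eq_of_lt hk] at this
      rw [ih _ _ h2]

theorem bs_mul_left_cancel (hm : 1 ≤ m) {r p q : BSMonoid n m} (h : r * p = r * q) : p = q := by
  induction r using bs_induction hm generalizing p q with
  | hb j => exact genB_pow_mul_left_cancel hm p j q h
  | ha i r hi ih =>
    rw [mul_assoc _ r, mul_assoc _ r] at h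
    exact ih (genB_pow_mul_genA_mul_inj_of_lt hm hi hi h).2

theorem bs_eq_one_of_mul_eq_one (hm : 1 ≤ m) {p q : BSMonoid n m} (h : p * q = 1) : p = 1 := by
  rw [← pow_zero (genB n m)] at h
  rcases bs_cases hm p with ⟨j, rfl⟩ | ⟨i, p, hi, rfl⟩
  · rcases bs_cases hm q with ⟨k, rfl⟩ | ⟨k, q, hk, rfl⟩
    · rw [← pow_add] at h
      have := genB_pow_injective hm h
      rw [show j = 0 by omega, pow_zero]
    · rw [← mul_assoc, ← mul_assoc, ← pow_add] at h
      exact absurd h.symm (genB_pow_ne hm _ _ _)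
  · rw [mul_assoc] at h
    exact absurd h.symm (genB_pow_ne hm _ _ _)

end Monoid

/-! ### Principal right ideals and left quotients. -/

section Ideals

variable {P : Type*} [Monoid P]

theorem mul_mem_rightIdeal (p q : P) : p * q ∈ rightIdeal p := ⟨q, rfl⟩

theorem self_mem_rightIdeal (p : P) : p ∈ rightIdeal p := ⟨1, (mul_one p).symm⟩

theorem rightIdeal_one : rightIdeal (1 : P) = Set.univ :=
  Set.eq_univ_of_forall fun x => ⟨x, (one_mul x).symm⟩

theorem rightIdeal_subset {p q : P} (h : p ∈ rightIdeal q) : rightIdeal p ⊆ rightIdeal q := by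
  obtain ⟨u, rfl⟩ := h
  rintro _ ⟨v, rfl⟩
  exact ⟨u * v, mul_assoc _ _ _⟩

theorem leftQuot_mul [IsLeftCancelMul P] (p u : P) : leftQuot p (p * u) = u := by
  have h : ∃ v, p * u = p * v := ⟨u, rfl⟩
  rw [leftQuot, dif_pos h]
  exact mul_left_cancel h.choose_spec.symm

end Ideals

/-! ### Intersections of principal right ideals and join-closed boxes. -/

section Join

variable {n m : ℕ}

theorem isLeftCancelMul_bs (hm : 1 ≤ m) : IsLeftCancelMul (BSMonoid n m) :=
  ⟨fun _ _ _ h => bs_mul_left_cancel hm h⟩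

theorem genB_pow_mem_rightIdeal_genB_pow (hm : 1 ≤ m) {j k : ℕ} :
    genB n m ^ k ∈ rightIdeal (genB n m ^ j) ↔ j ≤ k := by
  constructor
  · rintro ⟨u, hu⟩
    rcases bs_cases hm u with ⟨l, rfl⟩ | ⟨i, p, hi, rfl⟩
    · rw [← pow_add] at hu
      have := genB_pow_injective hm hu
      omega
    · rw [← mul_assoc, ← mul_assoc, ← pow_add] at hu
      exact absurd hu (genB_pow_ne hm _ _ _)
  · intro h
    exact ⟨genB n m ^ (k - j), by rw [← pow_add, Nat.add_sub_cancel' h]⟩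

theorem genB_pow_notMem_rightIdeal (hm : 1 ≤ m) (j i : ℕ) (p : BSMonoid n m) :
    genB n m ^ j ∉ rightIdeal (genB n m ^ i * genA n m * p) := by
  rintro ⟨u, hu⟩
  rw [mul_assoc] at hu
  exact genB_pow_ne hm _ _ _ hu

theorem mem_rightIdeal_genA_iff (hm : 1 ≤ m) {i k : ℕ} (hi : i < m) (hk : k < m)
    {p q : BSMonoid n m} :
    genB n m ^ k * genA n m * q ∈ rightIdeal (genB n m ^ i * genA n m * p) ↔
      i = k ∧ q ∈ rightIdeal p := by
  constructor
  · rintro ⟨u, hu⟩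
    rw [mul_assoc _ p] at hu
    obtain ⟨h1, h2⟩ := genB_pow_mul_genA_mul_inj_of_lt hm hk hi hu
    exact ⟨h1.symm, u, h2⟩
  · rintro ⟨rfl, u, rfl⟩
    exact ⟨u, by rw [← mul_assoc]⟩

theorem genB_pow_mod_mul_genA (j t : ℕ) (u : BSMonoid n m) :
    genB n m ^ ((j + t) % m) * genA n m * (genB n m ^ (n * ((j + t) / m)) * u) =
      genB n m ^ j * (genB n m ^ t * genA n m * u) := by
  rw [← mul_assoc, ← genB_pow_mul_genA', pow_add]
  simp only [mul_assoc]

/-- Writing the head as a rotation `(j + t) % m` records the carry `(j + t) / m`, which becomes a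
power of `b` on the tail. -/
theorem mem_rightIdeal_genB_pow_iff (hm : 1 ≤ m) {j t : ℕ} (ht : t < m) {y : BSMonoid n m} :
    genB n m ^ ((j + t) % m) * genA n m * y ∈ rightIdeal (genB n m ^ j) ↔
      y ∈ rightIdeal (genB n m ^ (n * ((j + t) / m))) := by
  constructor
  · rintro ⟨u, hu⟩
    rcases bs_cases hm u with ⟨l, rfl⟩ | ⟨i, p, hi, rfl⟩
    · rw [← pow_add] at hu
      exact absurd hu.symm (genB_pow_ne hm _ _ _)
    · rw [← mul_assoc, ← mul_assoc, ← pow_add] at hu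
      obtain ⟨h1, h2⟩ := genB_pow_mul_genA_mul_inj hm hu
      rw [Nat.mod_mod, Nat.div_eq_of_lt (Nat.mod_lt _ hm), mul_zero, pow_zero, one_mul] at *
      obtain rfl : t = i := by
        have := Nat.ModEq.add_left_cancel' j h1
        rwa [Nat.ModEq, Nat.mod_eq_of_lt hi, Nat.mod_eq_of_lt ht] at this
      exact ⟨p, h2⟩
  · rintro ⟨u, rfl⟩
    rw [genB_pow_mod_mul_genA]
    exact mul_mem_rightIdeal _ _

theorem add_mod_injOn (j : ℕ) :
    Set.InjOn (fun t => (j + t) % m) (Finset.range m : Set ℕ) := by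
  intro s hs t ht h
  simp only [Finset.coe_range, Set.mem_Iio] at hs ht
  have := Nat.ModEq.add_left_cancel' j h
  rwa [Nat.ModEq, Nat.mod_eq_of_lt hs, Nat.mod_eq_of_lt ht] at this

theorem add_mod_mapsTo (hm : 1 ≤ m) (j : ℕ) :
    Set.MapsTo (fun t => (j + t) % m) (Finset.range m : Set ℕ) (Finset.range m : Set ℕ) := by
  intro t _
  simpa using Nat.mod_lt _ hm

theorem add_mod_surjOn (hm : 1 ≤ m) (j : ℕ) :
    Set.SurjOn (fun t => (j + t) % m) (Finset.range m : Set ℕ) (Finset.range m : Set ℕ) :=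
  Finset.surjOn_of_injOn_of_card_le _ (add_mod_mapsTo hm j) (add_mod_injOn j) le_rfl

theorem exists_add_mod_eq (hm : 1 ≤ m) (j : ℕ) {i : ℕ} (hi : i < m) :
    ∃ t < m, (j + t) % m = i := by
  obtain ⟨t, ht, h⟩ := add_mod_surjOn hm j (a := i) (by simpa using hi)
  exact ⟨t, by simpa using ht, h⟩

/-- The set of the elements `b^{i₁}a⋯b^{i_l}a bʲ` with all `i_r < m`, with `l ≤ k`, and with `j` at
most the `l`-th iterate of `x ↦ n(x / m)` at `N`. -/
def box (n m : ℕ) : ℕ → ℕ → Set (BSMonoid n m)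
  | 0, N => {p | ∃ j ≤ N, p = genB n m ^ j}
  | k + 1, N => {p | (∃ j ≤ N, p = genB n m ^ j) ∨
      ∃ i < m, ∃ q ∈ box n m k (n * (N / m)), p = genB n m ^ i * genA n m * q}

theorem genB_pow_mem_box {k N j : ℕ} (h : j ≤ N) : genB n m ^ j ∈ box n m k N := by
  cases k with
  | zero => exact ⟨j, h, rfl⟩
  | succ k => exact .inl ⟨j, h, rfl⟩

/-- Each letter `a` costs one level and a factor `m` in the bound `N`. -/
theorem exists_mem_box (hn : 1 ≤ n) (hm : 1 ≤ m) (p : BSMonoid n m) :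
    ∃ k₀ N₀, ∀ k ≥ k₀, ∀ N ≥ N₀, p ∈ box n m k N := by
  refine bs_induction hm p (fun j => ⟨0, j, fun k _ N hN => genB_pow_mem_box hN⟩) ?_
  rintro i p hi ⟨k₀, N₀, h⟩
  refine ⟨k₀ + 1, m * N₀, fun k hk N hN => ?_⟩
  obtain ⟨k, rfl⟩ := Nat.exists_eq_add_of_le' (show 1 ≤ k by omega)
  refine .inr ⟨i, hi, p, h k (by omega) _ ?_, rfl⟩
  calc N₀ ≤ N / m := by rw [Nat.le_div_iff_mul_le hm, mul_comm]; exact hN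
    _ ≤ n * (N / m) := Nat.le_mul_of_pos_left _ hn

/-- Divisibility prevents an extra carry, so the power of `b` left on a tail stays in the next
smaller box. -/
theorem add_div_le_of_dvd (hm : 1 ≤ m) {N j t : ℕ} (hN : m ∣ N) (hj : j ≤ N) (ht : t < m) :
    (j + t) / m ≤ N / m := by
  obtain ⟨c, rfl⟩ := hN
  rw [Nat.mul_div_cancel_left _ hm, ← Nat.lt_succ_iff, Nat.div_lt_iff_lt_mul hm]
  nlinarith

/-- Any two elements of a subset `F` of the monoid that have a common right multiple have a least
one in `F`. -/
def JoinClosed {P : Type*} [Monoid P] (F : Set P) : Prop :=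
  ∀ p ∈ F, ∀ q ∈ F, rightIdeal p ∩ rightIdeal q = ∅ ∨
    ∃ r ∈ F, rightIdeal p ∩ rightIdeal q = rightIdeal r

theorem genB_pow_inter (hm : 1 ≤ m) (j k : ℕ) :
    rightIdeal (genB n m ^ j) ∩ rightIdeal (genB n m ^ k) = rightIdeal (genB n m ^ max j k) := by
  have key : ∀ {j k : ℕ}, j ≤ k → rightIdeal (genB n m ^ k) ⊆ rightIdeal (genB n m ^ j) :=
    fun h => rightIdeal_subset ((genB_pow_mem_rightIdeal_genB_pow hm).2 h)
  rcases le_total j k with h | h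
  · rw [max_eq_right h, Set.inter_eq_right.2 (key h)]
  · rw [max_eq_left h, Set.inter_eq_left.2 (key h)]

/-- Left translation carries principal right ideals to principal right ideals. -/
theorem image_rightIdeal {P : Type*} [Monoid P] (p q : P) :
    (fun y => p * y) '' rightIdeal q = rightIdeal (p * q) := by
  ext x
  constructor
  · rintro ⟨_, ⟨u, rfl⟩, rfl⟩
    exact ⟨u, (mul_assoc _ _ _).symm⟩
  · rintro ⟨u, rfl⟩
    exact ⟨q * u, ⟨u, rfl⟩, (mul_assoc _ _ _).symm⟩

theorem genB_pow_inter_genA (hm : 1 ≤ m) {j t : ℕ} (ht : t < m) (q : BSMonoid n m) :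
    rightIdeal (genB n m ^ j) ∩ rightIdeal (genB n m ^ ((j + t) % m) * genA n m * q) =
      (fun y => genB n m ^ ((j + t) % m) * genA n m * y) ''
        (rightIdeal (genB n m ^ (n * ((j + t) / m))) ∩ rightIdeal q) := by
  ext x
  constructor
  · rintro ⟨hx, u, rfl⟩
    rw [mul_assoc _ q] at hx ⊢
    exact ⟨q * u, ⟨(mem_rightIdeal_genB_pow_iff hm ht).1 hx, mul_mem_rightIdeal _ _⟩, rfl⟩
  · rintro ⟨y, ⟨hy, hq⟩, rfl⟩
    refine ⟨(mem_rightIdeal_genB_pow_iff hm ht).2 hy, ?_⟩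
    rw [← image_rightIdeal]
    exact ⟨y, hq, rfl⟩

/-- Powers of `b` form a chain and distinct heads are disjoint; the remaining intersections pull
back along a head to intersections of tails, one level down. -/
theorem joinClosed_box (hm : 1 ≤ m) (k : ℕ) : ∀ N, m ^ k ∣ N → JoinClosed (box n m k N) := by
  induction k with
  | zero =>
    rintro N - _ ⟨j, hj, rfl⟩ _ ⟨l, hl, rfl⟩
    exact .inr ⟨_, genB_pow_mem_box (max_le hj hl), genB_pow_inter hm j l⟩
  | succ k ih =>
    intro N hN
    have hmN : m ∣ N := (dvd_pow_self m k.succ_ne_zero).trans hN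
    have hN' : m ^ k ∣ n * (N / m) := by
      refine Dvd.dvd.mul_left ?_ n
      rw [Nat.dvd_div_iff_mul_dvd hmN, ← pow_succ']
      exact hN
    have hmix : ∀ j ≤ N, ∀ i < m, ∀ q ∈ box n m k (n * (N / m)),
        rightIdeal (genB n m ^ j) ∩ rightIdeal (genB n m ^ i * genA n m * q) = ∅ ∨
          ∃ r ∈ box n m (k + 1) N, rightIdeal (genB n m ^ j) ∩
            rightIdeal (genB n m ^ i * genA n m * q) = rightIdeal r := by
      intro j hj i hi q hq
      obtain ⟨t, ht, rfl⟩ := exists_add_mod_eq hm j hi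
      rw [genB_pow_inter_genA hm ht]
      rcases ih _ hN' _ (genB_pow_mem_box (Nat.mul_le_mul_left n
        (add_div_le_of_dvd hm hmN hj ht))) q hq with h | ⟨r, hr, h⟩
      · left; rw [h, Set.image_empty]
      · exact .inr ⟨_, .inr ⟨_, hi, r, hr, rfl⟩, by rw [h, image_rightIdeal]⟩
    rintro _ (⟨j, hj, rfl⟩ | ⟨i, hi, p, hp, rfl⟩) _ (⟨l, hl, rfl⟩ | ⟨l, hl, q, hq, rfl⟩)
    · exact .inr ⟨_, genB_pow_mem_box (max_le hj hl), genB_pow_inter hm j l⟩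
    · exact hmix j hj l hl q hq
    · rw [Set.inter_comm]
      exact hmix l hl i hi p hp
    · by_cases hil : i = l
      · subst hil
        rw [← image_rightIdeal, ← image_rightIdeal, ← Set.image_inter fun x y h =>
          bs_mul_left_cancel hm h]
        rcases ih _ hN' p hp q hq with h | ⟨r, hr, h⟩
        · left; rw [h, Set.image_empty]
        · exact .inr ⟨_, .inr ⟨_, hi, r, hr, rfl⟩, by rw [h, image_rightIdeal]⟩
      · left
        rw [Set.eq_empty_iff_forall_notMem]
        rintro _ ⟨⟨u, rfl⟩, h⟩
        rw [mul_assoc _ p, mem_rightIdeal_genA_iff hm hl hi] at h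
        exact hil h.1.symm

/-- Finitely many elements lie in a common box that is closed under joins. -/
theorem exists_box (hn : 1 ≤ n) (hm : 1 ≤ m) (s : Finset (BSMonoid n m)) :
    ∃ k N, m ^ k ∣ N ∧ (s : Set (BSMonoid n m)) ⊆ box n m k N := by
  choose K N h using exists_mem_box (n := n) hn hm
  refine ⟨s.sup K, m ^ s.sup K * s.sup N, Dvd.intro _ rfl, fun p hp => ?_⟩
  refine h p _ (Finset.le_sup (f := K) hp) _ ((Finset.le_sup (f := N) hp).trans ?_)
  exact Nat.le_mul_of_pos_left _ (Nat.pow_pos hm)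

/-- Any two elements with a common right multiple have a least one. -/
theorem joinClosed_univ (hn : 1 ≤ n) (hm : 1 ≤ m) :
    JoinClosed (Set.univ : Set (BSMonoid n m)) := by
  classical
  intro p _ q _
  obtain ⟨k, N, hN, h⟩ := exists_box hn hm {p, q}
  rcases joinClosed_box hm k N hN p (h (by simp)) q (h (by simp)) with h | ⟨r, -, h⟩
  · exact .inl h
  · exact .inr ⟨r, trivial, h⟩

end Join

/-! ### Joins of finite sets. -/

section Joins

variable {P : Type*} [Monoid P]

theorem mem_joinSet_pair {p q r : P} :
    r ∈ joinSet ({p, q} : Set P) ↔ rightIdeal p ∩ rightIdeal q = rightIdeal r := by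
  simp [joinSet]

theorem mem_joinSet_singleton (p : P) : p ∈ joinSet ({p} : Set P) := by
  simp [joinSet]

theorem one_mem_joinSet_empty : (1 : P) ∈ joinSet (∅ : Set P) := by
  simp [joinSet, rightIdeal_one]

theorem joinSet_eq_empty {F : Set P} (h : (⋂ x ∈ F, rightIdeal x) = ∅) : joinSet F = ∅ := by
  rw [Set.eq_empty_iff_forall_notMem]
  intro r hr
  have : r ∈ (⋂ x ∈ F, rightIdeal x) := by
    rw [show (⋂ x ∈ F, rightIdeal x) = rightIdeal r from hr]
    exact self_mem_rightIdeal r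
  rw [h] at this
  exact this

/-- Makes joins unique, so the choices in `kernel` and `rangeJoin` are canonical. -/
theorem eq_of_rightIdeal_eq [IsLeftCancelMul P] (hU : ∀ p q : P, p * q = 1 → p = 1) {r s : P}
    (h : rightIdeal r = rightIdeal s) : r = s := by
  obtain ⟨u, hu⟩ : r ∈ rightIdeal s := h ▸ self_mem_rightIdeal r
  obtain ⟨v, hv⟩ : s ∈ rightIdeal r := h ▸ self_mem_rightIdeal s
  have : s * (u * v) = s * 1 := by rw [← mul_assoc, ← hu, ← hv, mul_one]
  rw [hu, hU _ _ (mul_left_cancel this), mul_one]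

theorem joinSet_subsingleton [IsLeftCancelMul P] (hU : ∀ p q : P, p * q = 1 → p = 1) (F : Set P) :
    (joinSet F).Subsingleton :=
  fun _ hr _ hs => eq_of_rightIdeal_eq hU (Eq.trans (Eq.symm hr) hs)

theorem joinSet_union {U W : Set P} {r s : P} (hr : r ∈ joinSet U) (hs : s ∈ joinSet W) :
    joinSet (U ∪ W) = joinSet {r, s} := by
  have hr' : (⋂ x ∈ U, rightIdeal x) = rightIdeal r := hr
  have hs' : (⋂ x ∈ W, rightIdeal x) = rightIdeal s := hs
  ext t
  rw [mem_joinSet_pair, joinSet, Set.mem_ofPred_eq, Set.biInter_union, hr', hs']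

theorem JoinClosed.iInter_finset (hJ : JoinClosed (Set.univ : Set P)) (U : Finset P) :
    (⋂ x ∈ (U : Set P), rightIdeal x) = ∅ ∨ (joinSet (U : Set P)).Nonempty := by
  classical
  induction U using Finset.induction_on with
  | empty => exact .inr ⟨1, by simpa using one_mem_joinSet_empty⟩
  | insert a U _ ih =>
    rw [Finset.coe_insert, Set.biInter_insert]
    rcases ih with h | ⟨r, hr⟩
    · left; rw [h, Set.inter_empty]
    · have hr' : (⋂ x ∈ (U : Set P), rightIdeal x) = rightIdeal r := hr
      rw [hr']
      rcases hJ a trivial r trivial with h | ⟨s, -, hs⟩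
      · exact .inl h
      · right
        refine ⟨s, ?_⟩
        rw [Set.insert_eq, joinSet_union (mem_joinSet_singleton a) hr]
        exact mem_joinSet_pair.2 hs

theorem JoinClosed.joinSet_union_eq_empty (hJ : JoinClosed (Set.univ : Set P)) {U : Finset P}
    (hU : joinSet (U : Set P) = ∅) (W : Set P) : joinSet ((U : Set P) ∪ W) = ∅ := by
  rcases hJ.iInter_finset U with h | h
  · apply joinSet_eq_empty
    rw [Set.biInter_union, h, Set.empty_inter]
  · rw [hU] at h
    exact absurd h Set.not_nonempty_empty

end Joins

/-! ### Inclusion-exclusion for the kernel, and resolutions of the identity. -/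

section Operators

open scoped ComplexOrder

variable {P : Type*} [Monoid P] {H : Type*} [NormedAddCommGroup H] [InnerProductSpace ℂ H]
  [CompleteSpace H]

/-- The map `X ↦ T(p) X T(p)*`. -/
noncomputable def conj (T : P →* (H →L[ℂ] H)) (p : P) : (H →L[ℂ] H) →+ (H →L[ℂ] H) :=
  (AddMonoidHom.mulRight (star (T p))).comp (AddMonoidHom.mulLeft (T p))

theorem conj_apply (T : P →* (H →L[ℂ] H)) (p : P) (X : H →L[ℂ] H) :
    conj T p X = T p * X * star (T p) := rfl

theorem conj_mul (T : P →* (H →L[ℂ] H)) (p q : P) (X : H →L[ℂ] H) :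
    conj T (p * q) X = conj T p (conj T q X) := by
  simp only [conj_apply, map_mul, star_mul, mul_assoc]

theorem conj_one (T : P →* (H →L[ℂ] H)) (X : H →L[ℂ] H) : conj T 1 X = X := by
  simp [conj_apply]

theorem kernel_of_mem [IsLeftCancelMul P] (hU : ∀ p q : P, p * q = 1 → p = 1)
    (T : P →* (H →L[ℂ] H)) {p q u v : P} (h : p * u ∈ joinSet ({p, q} : Set P))
    (huv : p * u = q * v) : kernel T p q = T u * star (T v) := by
  have hne : (joinSet ({p, q} : Set P)).Nonempty := ⟨_, h⟩
  have hs : hne.some = p * u := joinSet_subsingleton hU _ hne.some_mem h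
  rw [kernel, dif_pos hne, hs, leftQuot_mul, huv, leftQuot_mul, ContinuousLinearMap.star_eq_adjoint]

theorem rangeJoin_of_mem [IsLeftCancelMul P] (hU : ∀ p q : P, p * q = 1 → p = 1)
    (T : P →* (H →L[ℂ] H)) {F : Set P} {s : P} (h : s ∈ joinSet F) :
    rangeJoin T F = conj T s 1 := by
  have hne : (joinSet F).Nonempty := ⟨_, h⟩
  have hs : hne.some = s := joinSet_subsingleton hU _ hne.some_mem h
  rw [rangeJoin, dif_pos hne, hs, conj_apply, mul_one, ContinuousLinearMap.star_eq_adjoint]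

theorem rangeJoin_of_eq_empty (T : P →* (H →L[ℂ] H)) {F : Set P} (h : joinSet F = ∅) :
    rangeJoin T F = 0 := by
  rw [rangeJoin, dif_neg (by simp [h])]

theorem kernel_of_eq_empty (T : P →* (H →L[ℂ] H)) {p q : P}
    (h : joinSet ({p, q} : Set P) = ∅) : kernel T p q = 0 := by
  rw [kernel, dif_neg (by simp [h])]

theorem mul_kernel_mul_star [IsLeftCancelMul P] (hU : ∀ p q : P, p * q = 1 → p = 1)
    (T : P →* (H →L[ℂ] H)) (p q : P) :
    T p * kernel T p q * star (T q) = rangeJoin T {p, q} := by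
  rcases (joinSet ({p, q} : Set P)).eq_empty_or_nonempty with h | ⟨s, hs⟩
  · rw [kernel_of_eq_empty T h, rangeJoin_of_eq_empty T h, mul_zero, zero_mul]
  · have h := mem_joinSet_pair.1 hs
    obtain ⟨⟨u, rfl⟩, v, huv⟩ : s ∈ rightIdeal p ∩ rightIdeal q := h ▸ self_mem_rightIdeal s
    rw [kernel_of_mem hU T hs huv, rangeJoin_of_mem hU T hs, conj_apply, mul_one]
    nth_rewrite 2 [huv]
    simp only [map_mul, star_mul, mul_assoc]

theorem IsCompletelyPosDef.sum_nonneg {K : P → P → (H →L[ℂ] H)} (hK : IsCompletelyPosDef K)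
    {ι : Type*} (s : Finset ι) (p : ι → P) (h : ι → H) :
    0 ≤ ∑ i ∈ s, ∑ j ∈ s, inner ℂ (h i) (K (p i) (p j) (h j)) := by
  have key := hK s.card (fun i => p (s.equivFin.symm i)) (fun i => h (s.equivFin.symm i))
  have e : ∀ f : ι → ℂ, ∑ i : Fin s.card, f (s.equivFin.symm i) = ∑ i ∈ s, f i := fun f => by
    rw [← Finset.sum_coe_sort s f]
    exact s.equivFin.symm.sum_comp fun i : s => f i
  rw [← e fun i => ∑ j ∈ s, inner ℂ (h i) (K (p i) (p j) (h j)),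
    Finset.sum_congr rfl fun i _ => (e fun j => inner ℂ (h _) (K (p _) (p j) (h j))).symm]
  exact Complex.nonneg_iff.2 ⟨key.1, key.2.symm⟩

/-- Inclusion-exclusion for a function of the union of two subsets. -/
theorem sum_powerset_sum_powerset_union {α R : Type*} [DecidableEq α] [CommRing R] (F : Finset α) :
    ∀ g : Finset α → R, ∑ U ∈ F.powerset, ∑ W ∈ F.powerset,
      (-1) ^ U.card * (-1) ^ W.card * g (U ∪ W) = ∑ X ∈ F.powerset, (-1) ^ X.card * g X := by
  induction F using Finset.induction_on with
  | empty => intro g; simp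
  | insert a F ha ih =>
    intro g
    have hins : ∀ f : Finset α → R, ∑ U ∈ F.powerset, (-1) ^ (insert a U).card * f U =
        -∑ U ∈ F.powerset, (-1) ^ U.card * f U := by
      intro f
      rw [← Finset.sum_neg_distrib]
      refine Finset.sum_congr rfl fun U hU => ?_
      rw [Finset.card_insert_of_notMem fun h => ha (Finset.mem_powerset.1 hU h), pow_succ]
      ring
    -- Split by whether `a` lies in `U` and in `W`: the three cases with `a ∈ U ∪ W` give the same
    -- sum with signs `-`, `-`, `+`.
    simp only [Finset.sum_powerset_insert ha, mul_assoc, ← Finset.mul_sum] at ih ⊢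
    simp only [hins, Finset.insert_union, Finset.union_insert, Finset.insert_idem,
      Finset.sum_add_distrib, mul_neg, Finset.sum_neg_distrib, ih]
    rw [ih fun X => g (insert a X)]
    ring

theorem isPositive_of_inner_nonneg {X : H →L[ℂ] H} (h : ∀ x, 0 ≤ inner ℂ x (X x)) :
    X.IsPositive := by
  rw [ContinuousLinearMap.isPositive_iff_complex]
  intro x
  obtain ⟨h1, h2⟩ := Complex.nonneg_iff.1 (h x)
  have e : inner ℂ (X x) x = inner ℂ x (X x) := by
    rw [← inner_conj_symm, Complex.conj_eq_iff_im, h2]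
  rw [e]
  exact ⟨Complex.ext rfl h2, h1⟩

/-- If the kernel of `T` is completely positive definite, then all `Z(F)` are positive. -/
theorem IsStarRegular.isPositive_Z [IsLeftCancelMul P] (hU : ∀ p q : P, p * q = 1 → p = 1)
    (hJ : JoinClosed (Set.univ : Set P)) {T : P →* (H →L[ℂ] H)} (hT : IsStarRegular T)
    (F : Finset P) : (Z T F).IsPositive := by
  classical
  refine isPositive_of_inner_nonneg fun x => ?_
  let s : Finset P → P := fun U => if h : (joinSet (U : Set P)).Nonempty then h.some else 1
  have hs : ∀ U : Finset P, (joinSet (U : Set P)).Nonempty → s U ∈ joinSet (U : Set P) := by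
    intro U h
    simp only [s, dif_pos h]
    exact h.some_mem
  -- The vector vanishes where `U` has no join, so the default point `1` of `s` contributes nothing.
  let v : Finset P → H := fun U =>
    if (joinSet (U : Set P)).Nonempty then (-1 : ℂ) ^ U.card • star (T (s U)) x else 0
  have key := hT.sum_nonneg F.powerset s v
  have hterm : ∀ U W : Finset P, inner ℂ (v U) (kernel T (s U) (s W) (v W)) =
      (-1 : ℂ) ^ U.card * (-1) ^ W.card *
        inner ℂ x (rangeJoin T ((U ∪ W : Finset P) : Set P) x) := by
    intro U W
    rw [Finset.coe_union]
    by_cases hU1 : (joinSet (U : Set P)).Nonempty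
    · by_cases hW1 : (joinSet (W : Set P)).Nonempty
      · have h1 : rangeJoin T ((U : Set P) ∪ W) = rangeJoin T {s U, s W} := by
          rw [rangeJoin, rangeJoin, joinSet_union (hs U hU1) (hs W hW1)]
        rw [h1, ← mul_kernel_mul_star hU]
        simp only [v, if_pos hU1, if_pos hW1, map_smul, inner_smul_left, inner_smul_right,
          ContinuousLinearMap.star_eq_adjoint, ContinuousLinearMap.adjoint_inner_left,
          mul_apply_eq_comp, map_pow, map_neg, map_one]
        ring
      · rw [Set.union_comm, rangeJoin_of_eq_empty T
          (hJ.joinSet_union_eq_empty (Set.not_nonempty_iff_eq_empty.1 hW1) _)]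
        simp [v, hW1]
    · rw [rangeJoin_of_eq_empty T
          (hJ.joinSet_union_eq_empty (Set.not_nonempty_iff_eq_empty.1 hU1) _)]
      simp [v, hU1]
  simp only [hterm] at key
  rw [sum_powerset_sum_powerset_union F fun X => inner ℂ x (rangeJoin T (X : Set P) x)] at key
  simpa only [Z, sum_apply, smul_apply, inner_sum,
    inner_smul_right] using key

open Classical in
/-- A resolution of the identity over `F`: finitely many points `s` of the monoid with positive
operators `D` such that the sum of `T(r⁻¹s) D T(r⁻¹s)*` over all `s ∈ rP` is `1` for all `r ∈ F`. -/
def HasResolution (T : P →* (H →L[ℂ] H)) (F : Set P) : Prop :=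
  ∃ (ι : Type) (_ : Fintype ι) (s : ι → P) (D : ι → H →L[ℂ] H), (∀ x, (D x).IsPositive) ∧
    ∀ r ∈ F, ∑ x, (if s x ∈ rightIdeal r then conj T (leftQuot r (s x)) (D x) else 0) = 1

-- With `r = pu = qv` the join, `K(p,q) = T(u) · 1 · T(v)*`; replace `1` by the resolution at `r`,
-- available because `F` is join-closed.
open Classical in
theorem kernel_eq_sum [IsLeftCancelMul P] (hU : ∀ p q : P, p * q = 1 → p = 1)
    {T : P →* (H →L[ℂ] H)} {F : Set P} (hF : JoinClosed F) {ι : Type} [Fintype ι] {s : ι → P}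
    {D : ι → H →L[ℂ] H} (hD : ∀ r ∈ F,
      ∑ x, (if s x ∈ rightIdeal r then conj T (leftQuot r (s x)) (D x) else 0) = 1)
    {p q : P} (hp : p ∈ F) (hq : q ∈ F) :
    kernel T p q = ∑ x, if s x ∈ rightIdeal p ∧ s x ∈ rightIdeal q then
      T (leftQuot p (s x)) * D x * star (T (leftQuot q (s x))) else 0 := by
  rcases hF p hp q hq with h | ⟨r, hr, h⟩
  · rw [kernel_of_eq_empty T (joinSet_eq_empty (by simpa using h))]
    refine (Finset.sum_eq_zero fun x _ => if_neg fun hx => ?_).symm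
    have : s x ∈ rightIdeal p ∩ rightIdeal q := hx
    rw [h] at this
    exact this
  · obtain ⟨⟨u, hu⟩, v, hv⟩ : r ∈ rightIdeal p ∩ rightIdeal q := h ▸ self_mem_rightIdeal r
    have hr' : p * u ∈ joinSet ({p, q} : Set P) := by rwa [mem_joinSet_pair, ← hu]
    rw [kernel_of_mem hU T hr' (hu.symm.trans hv), ← mul_one (T u), ← hD r hr, Finset.mul_sum,
      Finset.sum_mul]
    refine Finset.sum_congr rfl fun x _ => ?_
    have hiff : (s x ∈ rightIdeal p ∧ s x ∈ rightIdeal q) ↔ s x ∈ rightIdeal r := by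
      rw [← h]; rfl
    simp only [hiff]
    split_ifs with hx
    · obtain ⟨w, hw⟩ := hx
      have h1 : leftQuot r (s x) = w := by rw [hw, leftQuot_mul]
      have h2 : leftQuot p (s x) = u * w := by rw [hw, hu, mul_assoc, leftQuot_mul]
      have h3 : leftQuot q (s x) = v * w := by rw [hw, hv, mul_assoc, leftQuot_mul]
      rw [h1, h2, h3, conj_apply]
      simp only [map_mul, star_mul, mul_assoc]
    · rw [mul_zero, zero_mul]

theorem HasResolution.sum_nonneg [IsLeftCancelMul P] (hU : ∀ p q : P, p * q = 1 → p = 1)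
    {T : P →* (H →L[ℂ] H)} {F : Set P} (hF : JoinClosed F) (hR : HasResolution T F) {ι : Type*}
    [Fintype ι] (p : ι → P) (hp : ∀ i, p i ∈ F) (h : ι → H) :
    0 ≤ ∑ i, ∑ j, inner ℂ (h i) (kernel T (p i) (p j) (h j)) := by
  classical
  obtain ⟨κ, _, s, D, hpos, hD⟩ := hR
  -- The point `s x` then contributes the single quadratic form of `D x` at `∑ i, w x i`.
  let w : κ → ι → H := fun x i =>
    if s x ∈ rightIdeal (p i) then star (T (leftQuot (p i) (s x))) (h i) else 0
  have key : ∀ i j, inner ℂ (h i) (kernel T (p i) (p j) (h j)) =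
      ∑ x, inner ℂ (w x i) (D x (w x j)) := by
    intro i j
    rw [kernel_eq_sum hU hF hD (hp i) (hp j), sum_apply, inner_sum]
    refine Finset.sum_congr rfl fun x _ => ?_
    by_cases h1 : s x ∈ rightIdeal (p i)
    · by_cases h2 : s x ∈ rightIdeal (p j)
      · simp [w, h1, h2, ContinuousLinearMap.star_eq_adjoint,
          ContinuousLinearMap.adjoint_inner_left]
      · simp [w, h2]
    · simp [w, h1]
  have key2 : ∑ i, ∑ j, inner ℂ (h i) (kernel T (p i) (p j) (h j)) =
      ∑ x, inner ℂ (∑ i, w x i) (D x (∑ j, w x j)) := by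
    simp only [key]
    rw [Finset.sum_congr rfl fun i _ => Finset.sum_comm, Finset.sum_comm]
    refine Finset.sum_congr rfl fun x _ => ?_
    rw [sum_inner, map_sum]
    simp only [inner_sum]
  rw [key2]
  exact Finset.sum_nonneg fun x _ => (hpos x).inner_nonneg_right _

end Operators

/-! ### The three explicit `Z(F)` and the resolutions on boxes. -/

section BaumslagSolitar

variable {n m : ℕ} {H : Type*} [NormedAddCommGroup H] [InnerProductSpace ℂ H] [CompleteSpace H]

theorem genA_inter_genB (hm : 1 ≤ m) :
    rightIdeal (genA n m) ∩ rightIdeal (genB n m) = rightIdeal (genA n m * genB n m ^ n) := by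
  -- Here `t = m - 1`: the head of `a` is residue `0`, reached from `b` with carry exactly one.
  obtain ⟨t, ht, h⟩ := exists_add_mod_eq hm 1 (Nat.lt_of_lt_of_le Nat.zero_lt_one hm)
  have h1 : (1 + t) / m = 1 := by
    have h2 := Nat.div_add_mod (1 + t) m
    rw [h, add_zero] at h2
    have h3 : (1 + t) / m ≤ 1 := by
      rw [← Nat.lt_succ_iff, Nat.div_lt_iff_lt_mul hm]
      omega
    rcases Nat.le_one_iff_eq_zero_or_eq_one.1 h3 with h4 | h4
    · rw [h4] at h2; omega
    · exact h4
  have key := genB_pow_inter_genA hm (j := 1) ht (1 : BSMonoid n m)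
  rw [h, h1, pow_one, pow_zero, one_mul, mul_one, mul_one, rightIdeal_one, Set.inter_univ,
    image_rightIdeal] at key
  rw [Set.inter_comm, key]

theorem genA_ne_genB (hm : 1 ≤ m) : genA n m ≠ genB n m := by
  intro h
  refine genB_pow_ne (n := n) hm 1 0 1 ?_
  rw [pow_one, pow_zero, one_mul, mul_one, h]

theorem genB_pow_mul_genA_injOn (hm : 1 ≤ m) :
    Set.InjOn (fun i => genB n m ^ i * genA n m) (Finset.range m : Set ℕ) := by
  intro i hi j hj h
  simp only [Finset.coe_range, Set.mem_Iio] at hi hj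
  refine (genB_pow_mul_genA_mul_inj_of_lt (n := n) hm hi hj (p := 1) (q := 1) ?_).1
  rw [mul_one, mul_one]
  exact h

theorem Z_insert {P : Type*} [Monoid P] [DecidableEq P] (T : P →* (H →L[ℂ] H)) {F : Finset P}
    {x : P} (hx : x ∉ F) : Z T (insert x F) =
      Z T F - ∑ U ∈ F.powerset, (-1 : ℂ) ^ U.card • rangeJoin T (insert x (U : Set P)) := by
  rw [Z, Finset.sum_powerset_insert hx, Z, sub_eq_add_neg, ← Finset.sum_neg_distrib]
  congr 1
  refine Finset.sum_congr rfl fun U hU => ?_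
  rw [Finset.card_insert_of_notMem fun h => hx (Finset.mem_powerset.1 hU h), pow_succ,
    mul_neg_one, neg_smul, Finset.coe_insert]

variable (T : BSMonoid n m →* (H →L[ℂ] H))

theorem rangeJoin_bs (hm : 1 ≤ m) {F : Set (BSMonoid n m)} {s : BSMonoid n m}
    (h : s ∈ joinSet F) : rangeJoin T F = conj T s 1 :=
  have := isLeftCancelMul_bs (n := n) hm
  rangeJoin_of_mem (fun _ _ => bs_eq_one_of_mul_eq_one hm) T h

theorem Z_empty (hm : 1 ≤ m) : Z T ∅ = 1 := by
  rw [Z, Finset.powerset_empty, Finset.sum_singleton, Finset.coe_empty,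
    rangeJoin_bs T hm one_mem_joinSet_empty, conj_one, Finset.card_empty, pow_zero, one_smul]

theorem Z_singleton (hm : 1 ≤ m) (x : BSMonoid n m) : Z T {x} = 1 - conj T x 1 := by
  classical
  rw [← insert_empty_eq, Z_insert T (Finset.notMem_empty x), Z_empty T hm, Finset.powerset_empty,
    Finset.sum_singleton, Finset.coe_empty, insert_empty_eq,
    rangeJoin_bs T hm (mem_joinSet_singleton x), Finset.card_empty, pow_zero, one_smul]

open Classical in
theorem Z_pair (hm : 1 ≤ m) : Z T {genA n m, genB n m} =
    1 - conj T (genB n m) 1 - conj T (genA n m) 1 + conj T (genB n m ^ m * genA n m) 1 := by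
  rw [Z_insert T (by simpa using genA_ne_genB hm), Z_singleton T hm, ← insert_empty_eq,
    Finset.sum_powerset_insert (Finset.notMem_empty _), Finset.powerset_empty,
    Finset.sum_singleton, Finset.sum_singleton, Finset.coe_empty, insert_empty_eq,
    rangeJoin_bs T hm (mem_joinSet_singleton _), insert_empty_eq, Finset.coe_singleton,
    rangeJoin_bs T hm (mem_joinSet_pair.2 (genA_inter_genB hm)), genA_mul_genB_pow]
  simp only [Finset.card_empty, pow_zero, one_smul, Finset.card_singleton, pow_one, neg_smul]
  abel

/-- Subsets with two or more elements have no join, so only `∅` and singletons contribute. -/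
theorem Z_of_disjoint (hm : 1 ≤ m) (F : Finset (BSMonoid n m))
    (hF : (F : Set (BSMonoid n m)).Pairwise fun x y => rightIdeal x ∩ rightIdeal y = ∅) :
    Z T F = 1 - ∑ x ∈ F, conj T x 1 := by
  classical
  induction F using Finset.induction_on with
  | empty => rw [Z_empty T hm, Finset.sum_empty, sub_zero]
  | insert x F hx ih =>
    rw [Z_insert T hx, ih (hF.mono (by simp)), Finset.sum_insert hx,
      Finset.sum_eq_single (∅ : Finset (BSMonoid n m))]
    · rw [Finset.coe_empty, insert_empty_eq, rangeJoin_bs T hm (mem_joinSet_singleton x),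
        Finset.card_empty, pow_zero, one_smul]
      abel
    · intro U hU hne
      obtain ⟨y, hy⟩ := Finset.nonempty_iff_ne_empty.2 hne
      have hyF : y ∈ F := Finset.mem_powerset.1 hU hy
      have hxy : rightIdeal x ∩ rightIdeal y = ∅ :=
        hF (by simp) (by simp [hyF]) (by rintro rfl; exact hx hyF)
      rw [rangeJoin_of_eq_empty, smul_zero]
      apply joinSet_eq_empty
      rw [Set.biInter_insert, Set.eq_empty_iff_forall_notMem]
      rintro z ⟨hz, hz'⟩
      have : z ∈ rightIdeal x ∩ rightIdeal y := ⟨hz, Set.mem_iInter₂.1 hz' y hy⟩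
      rw [hxy] at this
      exact this
    · intro h
      exact absurd (Finset.empty_mem_powerset F) h

open Classical in
theorem Z_image (hm : 1 ≤ m) :
    Z T ((Finset.range m).image fun i => genB n m ^ i * genA n m) =
      1 - ∑ i ∈ Finset.range m, conj T (genB n m ^ i * genA n m) 1 := by
  rw [Z_of_disjoint T hm, Finset.sum_image (genB_pow_mul_genA_injOn hm)]
  rintro _ hx _ hy hxy
  simp only [Finset.coe_image, Set.mem_image, Finset.coe_range, Set.mem_Iio] at hx hy
  obtain ⟨i, hi, rfl⟩ := hx
  obtain ⟨j, hj, rfl⟩ := hy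
  rw [Set.eq_empty_iff_forall_notMem]
  rintro z ⟨⟨u, rfl⟩, v, hv⟩
  obtain rfl := (genB_pow_mul_genA_mul_inj_of_lt hm hi hj hv).1
  exact hxy rfl

theorem sum_conj_one_sub (d : ℕ) :
    ∑ t ∈ Finset.range d, conj T (genB n m ^ t) (1 - conj T (genB n m) 1) =
      1 - conj T (genB n m ^ d) 1 := by
  induction d with
  | zero => rw [Finset.sum_range_zero, pow_zero, conj_one, sub_self]
  | succ d ih =>
    rw [Finset.sum_range_succ, ih, map_sub, ← conj_mul, ← pow_succ]
    abel

/-- Telescoping: each summand is the difference of two consecutive windows of `m` exponents of `b`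
before `a`. -/
theorem sum_conj_shift (d : ℕ) :
    ∑ t ∈ Finset.range d, conj T (genB n m ^ t) (conj T (genA n m) 1 -
        conj T (genB n m ^ m * genA n m) 1) =
      ∑ i ∈ Finset.range m, conj T (genB n m ^ i * genA n m) 1 -
        conj T (genB n m ^ d) (∑ i ∈ Finset.range m, conj T (genB n m ^ i * genA n m) 1) := by
  have hconj : ∀ t s : ℕ, conj T (genB n m ^ t) (conj T (genB n m ^ s * genA n m) 1) =
      conj T (genB n m ^ (t + s) * genA n m) 1 := by
    intro t s
    rw [← conj_mul, ← mul_assoc, ← pow_add]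
  induction d with
  | zero => rw [Finset.sum_range_zero, pow_zero, conj_one, sub_self]
  | succ d ih =>
    rw [Finset.sum_range_succ, ih, map_sub, map_sum, map_sum, hconj]
    have h0 : conj T (genB n m ^ d) (conj T (genA n m) 1) =
        conj T (genB n m ^ (d + 0) * genA n m) 1 := by
      rw [← hconj, pow_zero, one_mul]
    -- A window of length `m + 1`, with its last and its first term split off in turn, compares the
    -- two windows.
    have h1 := Finset.sum_range_succ (fun i => conj T (genB n m ^ (d + i) * genA n m) 1) m
    rw [Finset.sum_range_succ'] at h1
    simp only [hconj, h0, add_right_comm d 1, ← add_assoc d] at h1 ⊢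
    rw [eq_sub_of_add_eq h1]
    abel

open Classical in
theorem sum_fin_genB_pow (hm : 1 ≤ m) (C E : H →L[ℂ] H) {j N : ℕ} (hj : j ≤ N) :
    ∑ x : Fin (N + 1), (if genB n m ^ (x : ℕ) ∈ rightIdeal (genB n m ^ j) then
      conj T (leftQuot (genB n m ^ j) (genB n m ^ (x : ℕ))) (if (x : ℕ) < N then C else E) else 0) =
    ∑ t ∈ Finset.range (N - j), conj T (genB n m ^ t) C + conj T (genB n m ^ (N - j)) E := by
  have := isLeftCancelMul_bs (n := n) hm
  obtain ⟨d, rfl⟩ := Nat.exists_eq_add_of_le hj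
  rw [Fin.sum_univ_eq_sum_range (fun x => if genB n m ^ x ∈ rightIdeal (genB n m ^ j) then
      conj T (leftQuot (genB n m ^ j) (genB n m ^ x)) (if x < j + d then C else E) else 0),
    add_assoc, Finset.sum_range_add, Finset.sum_eq_zero, zero_add, Finset.sum_range_succ,
    Nat.add_sub_cancel_left]
  · simp only [pow_add, mul_mem_rightIdeal, if_true, leftQuot_mul, lt_irrefl, if_false]
    congr 1
    refine Finset.sum_congr rfl fun t ht => ?_
    rw [if_pos (Nat.add_lt_add_left (Finset.mem_range.1 ht) j)]
  · intro x hx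
    rw [if_neg]
    rw [genB_pow_mem_rightIdeal_genB_pow hm]
    exact not_le.2 (Finset.mem_range.1 hx)

theorem hasResolution_box_zero (hm : 1 ≤ m) (hb : (1 - conj T (genB n m) 1).IsPositive) (N : ℕ) :
    HasResolution T (box n m 0 N) := by
  classical
  refine ⟨Fin (N + 1), inferInstance, fun x => genB n m ^ (x : ℕ),
    fun x => if (x : ℕ) < N then 1 - conj T (genB n m) 1 else 1, fun x => ?_, ?_⟩
  · dsimp only
    split_ifs
    · exact hb
    · exact ContinuousLinearMap.isPositive_one
  · rintro _ ⟨j, hj, rfl⟩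
    rw [sum_fin_genB_pow T hm _ _ hj, sum_conj_one_sub, sub_add_cancel]

-- Only the head `i` meets the ideal, and left quotients do not see the common head.
open Classical in
theorem sum_resolution_genA (hm : 1 ≤ m) {ι : Type} [Fintype ι] (s : ι → BSMonoid n m)
    (D : ι → H →L[ℂ] H) {i : ℕ} (hi : i < m) {r : BSMonoid n m} (hr : ∑ x, (if s x ∈ rightIdeal r
      then conj T (leftQuot r (s x)) (D x) else 0) = 1) :
    ∑ y : Fin m × ι, (if genB n m ^ (y.1 : ℕ) * genA n m * s y.2 ∈
        rightIdeal (genB n m ^ i * genA n m * r) then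
      conj T (leftQuot (genB n m ^ i * genA n m * r)
        (genB n m ^ (y.1 : ℕ) * genA n m * s y.2)) (D y.2) else 0) = 1 := by
  have := isLeftCancelMul_bs (n := n) hm
  rw [Fintype.sum_prod_type, Finset.sum_eq_single (⟨i, hi⟩ : Fin m), ← hr]
  · refine Finset.sum_congr rfl fun x _ => ?_
    simp only [mem_rightIdeal_genA_iff hm hi hi, true_and]
    split_ifs with h
    · obtain ⟨u, hu⟩ := h
      rw [hu, leftQuot_mul, ← mul_assoc, leftQuot_mul]
    · rfl
  · intro l _ hl
    refine Finset.sum_eq_zero fun x _ => if_neg ?_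
    rw [mem_rightIdeal_genA_iff hm hi l.2]
    exact fun h => hl (Fin.ext h.1.symm)
  · intro h
    exact absurd (Finset.mem_univ _) h

-- Rotation by `j` permutes the heads; over each head the resolution of the tails sums to `1`, so
-- the total does not depend on `j`.
open Classical in
theorem sum_resolution_genB (hm : 1 ≤ m) {ι : Type} [Fintype ι] (s : ι → BSMonoid n m)
    (D : ι → H →L[ℂ] H) {j : ℕ} (hr : ∀ t < m,
      ∑ x, (if s x ∈ rightIdeal (genB n m ^ (n * ((j + t) / m))) then
        conj T (leftQuot (genB n m ^ (n * ((j + t) / m))) (s x)) (D x) else 0) = 1) :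
    ∑ y : Fin m × ι, (if genB n m ^ (y.1 : ℕ) * genA n m * s y.2 ∈
        rightIdeal (genB n m ^ j) then
      conj T (leftQuot (genB n m ^ j)
        (genB n m ^ (y.1 : ℕ) * genA n m * s y.2)) (D y.2) else 0) =
      ∑ i ∈ Finset.range m, conj T (genB n m ^ i * genA n m) 1 := by
  have := isLeftCancelMul_bs (n := n) hm
  rw [Fintype.sum_prod_type, Fin.sum_univ_eq_sum_range (fun i => ∑ x,
    if genB n m ^ i * genA n m * s x ∈ rightIdeal (genB n m ^ j) then
      conj T (leftQuot (genB n m ^ j) (genB n m ^ i * genA n m * s x)) (D x) else 0)]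
  symm
  refine Finset.sum_nbij (fun t => (j + t) % m) (add_mod_mapsTo hm j) (add_mod_injOn j)
    (add_mod_surjOn hm j) fun t ht => ?_
  have ht' := Finset.mem_range.1 ht
  rw [← hr t ht', map_sum]
  refine Finset.sum_congr rfl fun x _ => ?_
  simp only [mem_rightIdeal_genB_pow_iff hm ht']
  split_ifs with h
  · obtain ⟨u, hu⟩ := h
    rw [hu, genB_pow_mod_mul_genA, leftQuot_mul, leftQuot_mul, conj_mul, conj_mul,
      conj_mul]
  · rw [map_zero]

/-- Let `S = ∑ T(bⁱa)T(bⁱa)*`, `d = N - j` and `β X = T(bᵈ) X T(bᵈ)*`. At `r = bʲ` the weights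
`Z{a,b}` telescope to `1 - β 1 - S + β S`, the end weight `1 - S` gives `β 1 - β S`, and the heads
give `S`; the total is `1`. -/
theorem hasResolution_box_succ (hm : 1 ≤ m)
    (hC : (1 - conj T (genB n m) 1 - conj T (genA n m) 1 +
      conj T (genB n m ^ m * genA n m) 1).IsPositive)
    (hE : (1 - ∑ i ∈ Finset.range m, conj T (genB n m ^ i * genA n m) 1).IsPositive)
    {k N : ℕ} (hN : m ∣ N) (h : HasResolution T (box n m k (n * (N / m)))) :
    HasResolution T (box n m (k + 1) N) := by
  classical
  obtain ⟨ι, _, s, D, hD, hs⟩ := h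
  refine ⟨Fin (N + 1) ⊕ Fin m × ι, inferInstance,
    Sum.elim (fun x => genB n m ^ (x : ℕ)) fun y => genB n m ^ (y.1 : ℕ) * genA n m * s y.2,
    Sum.elim (fun x => if (x : ℕ) < N then 1 - conj T (genB n m) 1 - conj T (genA n m) 1 +
      conj T (genB n m ^ m * genA n m) 1 else
      1 - ∑ i ∈ Finset.range m, conj T (genB n m ^ i * genA n m) 1) fun y => D y.2, ?_, ?_⟩
  · rintro (x | y)
    · simp only [Sum.elim_inl]
      split_ifs
      · exact hC
      · exact hE
    · exact hD y.2
  · intro r hr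
    refine (Fintype.sum_sum_type _).trans ?_
    rcases hr with ⟨j, hj, rfl⟩ | ⟨i, hi, q, hq, rfl⟩
    · refine (congrArg₂ (· + ·) (sum_fin_genB_pow T hm _ _ hj)
        (sum_resolution_genB T hm s D fun t ht =>
          hs _ (genB_pow_mem_box (Nat.mul_le_mul_left n (add_div_le_of_dvd hm hN hj ht))))).trans ?_
      simp only [sub_add (1 - conj T (genB n m) 1),
        map_sub (conj T (genB n m ^ _)) (1 - conj T (genB n m) 1),
        Finset.sum_sub_distrib, sum_conj_one_sub, sum_conj_shift]
      rw [map_sub]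
      abel
    · refine (congrArg₂ (· + ·) (Finset.sum_eq_zero fun x _ => if_neg ?_)
        (sum_resolution_genA T hm s D hi (hs q hq))).trans (zero_add _)
      exact genB_pow_notMem_rightIdeal hm _ _ _

theorem hasResolution_box (hm : 1 ≤ m) (hb : (1 - conj T (genB n m) 1).IsPositive)
    (hC : (1 - conj T (genB n m) 1 - conj T (genA n m) 1 +
      conj T (genB n m ^ m * genA n m) 1).IsPositive)
    (hE : (1 - ∑ i ∈ Finset.range m, conj T (genB n m ^ i * genA n m) 1).IsPositive) (k : ℕ) :
    ∀ N, m ^ k ∣ N → HasResolution T (box n m k N) := by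
  induction k with
  | zero => exact fun N _ => hasResolution_box_zero T hm hb N
  | succ k ih =>
    intro N hN
    have hmN : m ∣ N := (dvd_pow_self m k.succ_ne_zero).trans hN
    refine hasResolution_box_succ T hm hC hE hmN (ih _ (Dvd.dvd.mul_left ?_ n))
    rw [Nat.dvd_div_iff_mul_dvd hmN, ← pow_succ']
    exact hN

end BaumslagSolitar

end RegDil

theorem mainTheorem8 (n m : ℕ) (hn : 1 ≤ n) (hm : 1 ≤ m)
    {H : Type*} [NormedAddCommGroup H] [InnerProductSpace ℂ H] [CompleteSpace H]
    (T : RegDil.BSMonoid n m →* (H →L[ℂ] H)) (hT : ∀ p, ‖T p‖ ≤ 1) :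
    RegDil.IsStarRegular T ↔
      ∀ F : Finset (RegDil.BSMonoid n m), (F : Set (RegDil.BSMonoid n m)) ⊆ RegDil.P00 n m →
        (RegDil.Z T F).IsPositive := by
  classical
  have := RegDil.isLeftCancelMul_bs (n := n) hm
  have hU : ∀ p q : RegDil.BSMonoid n m, p * q = 1 → p = 1 :=
    fun _ _ => RegDil.bs_eq_one_of_mul_eq_one hm
  constructor
  · exact fun h F _ => h.isPositive_Z hU (RegDil.joinClosed_univ hn hm) F
  · intro h N p v
    have hbP : RegDil.genB n m ∈ RegDil.P00 n m := .inl rfl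
    have haP : ∀ i < m, RegDil.genB n m ^ i * RegDil.genA n m ∈ RegDil.P00 n m :=
      fun i hi => .inr ⟨i, hi, rfl⟩
    have hb := h {RegDil.genB n m} (by simpa using hbP)
    have hC := h {RegDil.genA n m, RegDil.genB n m} (by
      have := haP 0 hm
      rw [pow_zero, one_mul] at this
      simp [Set.insert_subset_iff, hbP, this])
    have hE := h ((Finset.range m).image fun i => RegDil.genB n m ^ i * RegDil.genA n m) (by
      intro x hx
      simp only [Finset.coe_image, Set.mem_image, Finset.coe_range, Set.mem_Iio] at hx
      obtain ⟨i, hi, rfl⟩ := hx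
      exact haP i hi)
    rw [RegDil.Z_singleton T hm] at hb
    rw [RegDil.Z_pair T hm] at hC
    rw [RegDil.Z_image T hm] at hE
    -- The three positivity conditions resolve the identity on any box with `m ^ k ∣ M`, hence on
    -- one containing all `p i`.
    obtain ⟨k, M, hM, hp⟩ := RegDil.exists_box hn hm (Finset.univ.image p)
    have := (RegDil.hasResolution_box T hm hb hC hE k M hM).sum_nonneg hU
      (RegDil.joinClosed_box hm k M hM) p (fun i => hp (by simp)) v
    exact ⟨(Complex.nonneg_iff.1 this).1, (Complex.nonneg_iff.1 this).2.symm⟩
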